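/- All alphabets are finite. A pseudovariety of semigroups is a class of finite semigroups closed under taking subsemigroups, homomorphic images and finitary direct products; $\mathsf S$ denotes the pseudovariety of all finite semigroups. For a pseudovariety $\mathsf V$ and an alphabet $A$, let $\overline{\Omega}_A\mathsf V$ be the free pro-$\mathsf V$ semigroup on $A$, and let $\pi\mapsto[\pi]_{\mathsf V}$ be the natural projection $\overline{\Omega}_A\mathsf S\to\overline{\Omega}_A\mathsf V$. The elements of $\overline{\Omega}_A\mathsf S$ are called pseudowords, and the free semigroup $A^+$ is identified with the subsemigroup of $\overline{\Omega}_A\mathsf S$ generated by $A$. An element $s$ of a semigroup $S$ is regular if $s\in sSs$. A pseudoword $\pi\in\overline{\Omega}_A\mathsf S$ is $\mathsf V$-multiregular if $[\pi]_{\mathsf V}$ is a (nonempty) finite product of regular elements of $\overline{\Omega}_A\mathsf V$. A pseudovariety $\mathsf W$ is organizing if, for every alphabet $A$, every $\pi\in\overline{\Omega}_A\mathsf S$ has a factorization $\pi=u_0\pi_1u_1\pi_2\cdots\pi_{n-1}u_{n-1}\pi_nu_n$ for some $n\ge 0$, where $u_0,u_n\in A^*$, $u_i\in A^+$ for $1\le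 i\le n-1$, and, for $1\le i\le n$, $\pi_i\in\overline{\Omega}_A\mathsf S\setminus A^+$ is $\mathsf W$-multiregular. A language $L\subseteq A^+$ is $\mathsf V$-recognizable if $L=\varphi^{-1}(\varphi(L))$ for some homomorphism $\varphi$ from $A^+$ into a semigroup of $\mathsf V$. The pseudovariety $\mathsf V$ is closed under bideterministic product if, for every alphabet $A$, every letter $a\in A$ and all $L,K\subseteq A^*$ each of which is either a $\mathsf V$-recognizable language contained in $A^+$ or the language $\{1\}$, the language $LaK$ is $\mathsf V$-recognizable whenever $La$ is a prefix code (no element of $La$ is a proper prefix of an element of $La$) and $aK$ is a suffix code (no element of $aK$ is a proper suffix of an element of $aK$). A pseudoidentity $\pi=\rho$ is a formal equality of two pseudowords $\pi,\rho\in\overline{\Omega}_A\mathsf S$ over some alphabet $A$; a finite semigroup $S$ satisfies it if $\widehat\varphi(\pi)=\widehat\varphi(\rho)$ for every map $\varphi\colon A\to S$, where $\widehat\varphi\colon\overline{\Omega}_A\mathsf S\to S$ is the continuous homomorphism extending $\varphi$. A set $\Sigma$ of pseudoidentities is a basis of $\mathsf V$ if $\mathsf V$ is the class of all finite semigroups that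 satisfy every pseudoidentity in $\Sigma$. **Corollary.** Let $\mathsf V$ be a pseudovariety of semigroups closed under bideterministic product, and let $\mathsf W$ be an organizing pseudovariety of semigroups containing $\mathsf V$. Then $\mathsf V$ has a basis $\Sigma$ such that, for every pseudoidentity $(\pi=\rho)$ in $\Sigma$, both $\pi$ and $\rho$ are $\mathsf W$-multiregular pseudowords. -/

import Mathlib

/-- A pseudovariety of semigroups: a class of finite (nonempty) semigroups closed under
subsemigroups, homomorphic images and finitary direct products (the empty product being the
trivial semigroup). The class is recorded on semigroups in `Type`; as it is closed under
isomorphism and its members are finite, this is no restriction. -/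
structure Pseudovariety where
  Mem : (S : Type) → [Semigroup S] → Prop
  finite_of_mem : ∀ (S : Type) [Semigroup S], Mem S → Finite S
  nonempty_of_mem : ∀ (S : Type) [Semigroup S], Mem S → Nonempty S
  subsemigroup_mem : ∀ (S : Type) [Semigroup S] (T : Subsemigroup S), Mem S → Nonempty T → Mem T
  image_mem : ∀ (S T : Type) [Semigroup S] [Semigroup T] (f : S →ₙ* T),
    Function.Surjective f → Mem S → Mem T
  prod_mem : ∀ (S T : Type) [Semigroup S] [Semigroup T], Mem S → Mem T → Mem (S × T)
  unit_mem : Mem Unit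

namespace Pseudovariety

/-- Inclusion of pseudovarieties. -/
instance : LE Pseudovariety where
  le V W := ∀ (S : Type) [Semigroup S], V.Mem S → W.Mem S

/-- The pseudovariety of all finite semigroups. -/
def all : Pseudovariety where
  Mem S _ := Finite S ∧ Nonempty S
  finite_of_mem _ _ h := h.1
  nonempty_of_mem _ _ h := h.2
  subsemigroup_mem S _ T h hT := ⟨haveI := h.1; inferInstance, hT⟩
  image_mem S T _ _ f hf h :=
    ⟨haveI := h.1; Finite.of_surjective f hf, h.2.map f⟩
  prod_mem S T _ _ hS hT := by
    obtain ⟨_, _⟩ := hS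
    obtain ⟨_, _⟩ := hT
    exact ⟨inferInstance, inferInstance⟩
  unit_mem := ⟨inferInstance, inferInstance⟩

theorem le_all (V : Pseudovariety) : V ≤ all :=
  fun S _ h => ⟨V.finite_of_mem S h, V.nonempty_of_mem S h⟩

/-- The congruences `c` on the free semigroup `A⁺` such that `A⁺ / c` belongs to `V`. -/
def Cong (V : Pseudovariety) (A : Type) : Type :=
  {c : Con (FreeSemigroup A) // V.Mem c.Quotient}

/-- The quotient `A⁺ / c`, a finite semigroup of `V`, with the discrete topology. -/
def FinQuot (V : Pseudovariety) (A : Type) (c : V.Cong A) : Type := c.1.Quotient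

instance (V : Pseudovariety) (A : Type) (c : V.Cong A) : Semigroup (V.FinQuot A c) :=
  inferInstanceAs (Semigroup c.1.Quotient)

instance (V : Pseudovariety) (A : Type) (c : V.Cong A) : Finite (V.FinQuot A c) :=
  V.finite_of_mem _ c.2

instance (V : Pseudovariety) (A : Type) (c : V.Cong A) : TopologicalSpace (V.FinQuot A c) := ⊥

instance (V : Pseudovariety) (A : Type) (c : V.Cong A) : DiscreteTopology (V.FinQuot A c) := ⟨rfl⟩

/-- The diagonal homomorphism from `A⁺` to the product of all its quotients in `V`. -/
def diag (V : Pseudovariety) (A : Type) : FreeSemigroup A →ₙ* ((c : V.Cong A) → V.FinQuot A c) where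
  toFun w c := Con.toQuotient (c := c.1) w
  map_mul' _ _ := rfl

/-- The free pro-`V` semigroup on the alphabet `A`: the closure of the image of `A⁺` in the
product of all its (finite, discrete) quotients in `V`, with the subspace topology. For
`V = all` its elements are the pseudowords over `A`. -/
abbrev FreePro (V : Pseudovariety) (A : Type) : Type := (diag V A).srange.topologicalClosure

/-- The canonical homomorphism from `A⁺` to the free pro-`V` semigroup on `A`. -/
def ofWord (V : Pseudovariety) (A : Type) : FreeSemigroup A →ₙ* V.FreePro A where
  toFun w := ⟨diag V A w, Subsemigroup.le_topologicalClosure _ ⟨w, rfl⟩⟩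
  map_mul' _ _ := rfl

/-- The canonical map from the alphabet `A` to the free pro-`V` semigroup on `A`. -/
def letter (V : Pseudovariety) (A : Type) (a : A) : V.FreePro A := V.ofWord A (FreeSemigroup.of a)

instance (V : Pseudovariety) (A : Type) : CompactSpace (V.FreePro A) :=
  isCompact_iff_compactSpace.mp (Subsemigroup.isClosed_topologicalClosure _).isCompact

theorem denseRange_ofWord (V : Pseudovariety) (A : Type) : DenseRange (V.ofWord A) := by
  intro x
  rw [closure_subtype, ← Set.range_comp]
  exact x.2

theorem nonempty_of_freePro {V : Pseudovariety} {A : Type} (u : V.FreePro A) :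
    Nonempty (FreeSemigroup A) := by
  obtain ⟨_, w, _⟩ := closure_nonempty_iff.mp ⟨u.1, u.2⟩
  exact ⟨w⟩

theorem ker_mem (V : Pseudovariety) {A S : Type} [Semigroup S] (hS : V.Mem S)
    (f : FreeSemigroup A →ₙ* S) (hA : Nonempty (FreeSemigroup A)) : V.Mem (Con.ker f).Quotient := by
  have hr : V.Mem f.srange := V.subsemigroup_mem S _ hS (hA.map f.srangeRestrict)
  let g : (Con.ker f).Quotient → S := fun x => Con.liftOn x f fun _ _ h => h
  have hg : Function.Injective g := by
    intro x y
    induction x, y using Con.induction_on₂ with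
    | _ x y => exact fun h => (Con.eq _).mpr h
  have hgm : ∀ x y, g (x * y) = g x * g y := by
    intro x y
    induction x, y using Con.induction_on₂ with
    | _ x y => exact map_mul f x y
  have hs : ∀ s : f.srange, ∃ x, g x = s.1 := by
    rintro ⟨_, w, rfl⟩
    exact ⟨w, rfl⟩
  choose h hh using hs
  refine V.image_mem f.srange _ ⟨h, ?_⟩ ?_ hr
  · intro s t
    apply hg
    rw [hgm, hh, hh, hh]
    rfl
  · intro x
    induction x using Con.induction_on with
    | _ w => exact ⟨⟨f w, w, rfl⟩, hg (hh _)⟩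

/-- The kernel of the homomorphism `A⁺ → S` induced by a map `φ : A → S`, where `S` is in `V`. -/
def kerCong (V : Pseudovariety) {A S : Type} [Semigroup S] (hS : V.Mem S) (φ : A → S)
    (hA : Nonempty (FreeSemigroup A)) : V.Cong A :=
  ⟨Con.ker (FreeSemigroup.lift φ), V.ker_mem hS _ hA⟩

/-- The injective homomorphism from `A⁺ / ker` to `S` induced by `φ`. -/
def kerHom (V : Pseudovariety) {A S : Type} [Semigroup S] (hS : V.Mem S) (φ : A → S)
    (hA : Nonempty (FreeSemigroup A)) : V.FinQuot A (V.kerCong hS φ hA) →ₙ* S where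
  toFun x := Con.liftOn (c := Con.ker (FreeSemigroup.lift φ)) x (FreeSemigroup.lift φ)
    (fun _ _ h => h)
  map_mul' x y :=
    Con.induction_on₂ (c := Con.ker (FreeSemigroup.lift φ))
      (d := Con.ker (FreeSemigroup.lift φ)) x y
      (fun a b => map_mul (FreeSemigroup.lift φ) a b)

/-- For a semigroup `S` of `V` and a map `φ : A → S`, the homomorphism from the free pro-`V`
semigroup on `A` to `S` which extends `φ`: it reads off the component at the kernel of the induced
homomorphism `A⁺ → S`. By the facts below it is the unique continuous extension of `φ`. -/
def extend (V : Pseudovariety) {A S : Type} [Semigroup S] (hS : V.Mem S) (φ : A → S) :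
    V.FreePro A →ₙ* S where
  toFun u := V.kerHom hS φ (nonempty_of_freePro u) (u.1 (V.kerCong hS φ (nonempty_of_freePro u)))
  map_mul' u v := map_mul (V.kerHom hS φ (nonempty_of_freePro u))
    (u.1 (V.kerCong hS φ (nonempty_of_freePro u))) (v.1 (V.kerCong hS φ (nonempty_of_freePro u)))

theorem extend_ofWord (V : Pseudovariety) {A S : Type} [Semigroup S] (hS : V.Mem S) (φ : A → S)
    (w : FreeSemigroup A) : V.extend hS φ (V.ofWord A w) = FreeSemigroup.lift φ w := rfl

theorem extend_letter (V : Pseudovariety) {A S : Type} [Semigroup S] (hS : V.Mem S) (φ : A → S)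
    (a : A) : V.extend hS φ (V.letter A a) = φ a := rfl

theorem continuous_extend (V : Pseudovariety) {A S : Type} [Semigroup S] [TopologicalSpace S]
    (hS : V.Mem S) (φ : A → S) : Continuous (V.extend hS φ) := by
  rcases isEmpty_or_nonempty (V.FreePro A) with h | ⟨⟨u₀⟩⟩
  · exact continuous_of_discreteTopology
  have hg : Continuous (V.kerHom hS φ (nonempty_of_freePro u₀)) := continuous_of_discreteTopology
  exact hg.comp ((continuous_apply (V.kerCong hS φ (nonempty_of_freePro u₀))).comp
    continuous_subtype_val)

/-- The extension of `φ` is the only continuous homomorphism which agrees with `φ` on letters. -/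
theorem eq_extend (V : Pseudovariety) {A S : Type} [Semigroup S] [TopologicalSpace S]
    [DiscreteTopology S] (hS : V.Mem S) (φ : A → S) (Φ : V.FreePro A →ₙ* S) (hΦ : Continuous Φ)
    (h : ∀ a, Φ (V.letter A a) = φ a) : Φ = V.extend hS φ := by
  have key : Φ.comp (V.ofWord A) = (V.extend hS φ).comp (V.ofWord A) :=
    FreeSemigroup.hom_ext (funext h)
  exact DFunLike.coe_injective ((V.denseRange_ofWord A).equalizer hΦ (V.continuous_extend hS φ)
    (funext fun w => DFunLike.congr_fun key w))

/-- A congruence with quotient in `V`, viewed as a congruence with finite quotient. -/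
def Cong.toAll {V : Pseudovariety} {A : Type} (c : V.Cong A) : all.Cong A := ⟨c.1, V.le_all _ c.2⟩

/-- The restriction of a family indexed by the congruences with finite quotient to the congruences
with quotient in `V`. -/
def restrict (V : Pseudovariety) (A : Type) (f : (c : all.Cong A) → all.FinQuot A c) :
    (c : V.Cong A) → V.FinQuot A c :=
  fun c => f c.toAll

theorem continuous_restrict (V : Pseudovariety) (A : Type) : Continuous (V.restrict A) := by
  refine continuous_pi fun c => ?_
  let g : all.FinQuot A c.toAll → V.FinQuot A c := fun x => x
  have hg : Continuous g := continuous_of_discreteTopology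
  exact hg.comp (continuous_apply c.toAll)

/-- The natural projection `π ↦ [π]_V` from the free profinite semigroup on `A` to the free pro-`V`
semigroup on `A`. -/
def proj (V : Pseudovariety) (A : Type) : all.FreePro A →ₙ* V.FreePro A where
  toFun u := ⟨V.restrict A u.1, map_mem_closure (V.continuous_restrict A) u.2 (by
    rintro _ ⟨w, rfl⟩
    exact ⟨w, rfl⟩)⟩
  map_mul' _ _ := rfl

theorem continuous_proj (V : Pseudovariety) (A : Type) : Continuous (V.proj A) :=
  ((V.continuous_restrict A).comp continuous_subtype_val).subtype_mk _

theorem proj_letter (V : Pseudovariety) (A : Type) (a : A) :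
    V.proj A (all.letter A a) = V.letter A a := rfl

end Pseudovariety

/-- The pseudowords over the alphabet `A`: the elements of the free profinite semigroup on `A`. -/
abbrev Pseudoword (A : Type) : Type := Pseudovariety.all.FreePro A

/-- A pseudoidentity in variables of a finite alphabet. -/
structure Pseudoidentity where
  alphabet : Type
  finite_alphabet : Finite alphabet
  lhs : Pseudoword alphabet
  rhs : Pseudoword alphabet

/-- The finite semigroup `S` satisfies the pseudoidentity `e`: the two sides have the same image
under the continuous extension of every map from the alphabet to `S`. -/
def Pseudoidentity.Satisfied (e : Pseudoidentity) (S : Type) [Semigroup S]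
    (hS : Pseudovariety.all.Mem S) : Prop :=
  ∀ φ : e.alphabet → S,
    Pseudovariety.all.extend hS φ e.lhs = Pseudovariety.all.extend hS φ e.rhs

namespace Pseudovariety

/-- `Σ` is a basis of `V`: the members of `V` are precisely the finite semigroups which satisfy all
pseudoidentities of `Σ`. -/
def IsBasis (V : Pseudovariety) (Sg : Set Pseudoidentity) : Prop :=
  ∀ (S : Type) [Semigroup S] (hS : all.Mem S), V.Mem S ↔ ∀ e ∈ Sg, e.Satisfied S hS

/-- The regular elements of a semigroup. -/
def regularElements (S : Type) [Semigroup S] : Set S := {s | ∃ t, s = s * t * s}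

/-- A pseudoword `π` is `V`-multiregular if `[π]_V` is a (nonempty, finite) product of regular
elements of the free pro-`V` semigroup. -/
def IsMultiregular (V : Pseudovariety) {A : Type} (p : Pseudoword A) : Prop :=
  V.proj A p ∈ Subsemigroup.closure (regularElements (V.FreePro A))

/-- `V` has a basis of pseudoidentities between `W`-multiregular pseudowords (this is used only
for `V ≤ W`). -/
def MultiregularlyBasedIn (V W : Pseudovariety) : Prop :=
  ∃ Sg : Set Pseudoidentity, V.IsBasis Sg ∧
    ∀ e ∈ Sg, W.IsMultiregular e.lhs ∧ W.IsMultiregular e.rhs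

end Pseudovariety

/-- The (possibly empty) word `w` as an element of the free profinite semigroup on `A` with a
neutral element adjoined. -/
def wordPseudo {A : Type} (w : List A) : WithOne (Pseudoword A) :=
  (w.map fun a => (Pseudovariety.all.letter A a : WithOne (Pseudoword A))).prod

namespace Pseudovariety

/-- The pseudoword `π` has a factorization `u₀ π₁ u₁ π₂ ⋯ uₙ₋₁ πₙ uₙ`, for some `n ≥ 0`, with
`u₀, uₙ ∈ A*`, with `uᵢ ∈ A⁺` for `1 ≤ i ≤ n - 1`, and with `W`-multiregular `πᵢ ∉ A⁺` for
`1 ≤ i ≤ n`. (Here `p i` stands for the factor between `u i` and `u (i + 1)`.) -/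
def MultiregularlyOrganized (W : Pseudovariety) {A : Type} (q : Pseudoword A) : Prop :=
  ∃ (n : ℕ) (u : Fin (n + 1) → List A) (p : Fin n → Pseudoword A),
    (∀ i, i ≠ 0 → i ≠ Fin.last n → u i ≠ []) ∧
    (∀ i, p i ∉ Set.range (all.ofWord A)) ∧
    (∀ i, W.IsMultiregular (p i)) ∧
    (q : WithOne (Pseudoword A)) = wordPseudo (u 0) *
      (List.ofFn fun i : Fin n => (p i : WithOne (Pseudoword A)) * wordPseudo (u i.succ)).prod

/-- A pseudovariety `W` is organizing if every pseudoword over a finite alphabet is multiregularly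
organized in `W`. -/
def Organizing (W : Pseudovariety) : Prop :=
  ∀ (A : Type) [Finite A] (q : Pseudoword A), W.MultiregularlyOrganized q

/-- The language `L` is a `V`-recognizable `+`-language, that is, `L` consists of nonempty words
and, as a subset of the free semigroup `A⁺`, it satisfies `L = φ⁻¹(φ(L))` for some homomorphism `φ`
from `A⁺` to a semigroup of `V`. -/
def Recognizable (V : Pseudovariety) {A : Type} (L : Language A) : Prop :=
  ∃ L' : Set (FreeSemigroup A), L = (fun w : FreeSemigroup A => w.head :: w.tail) '' L' ∧
    ∃ (S : Type) (_ : Semigroup S) (φ : FreeSemigroup A →ₙ* S), V.Mem S ∧ L' = φ ⁻¹' (φ '' L')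

end Pseudovariety

/-- No word of `L` is a proper prefix of a word of `L`. -/
def IsPrefixCode {A : Type} (L : Language A) : Prop :=
  ∀ u ∈ L, ∀ w : List A, w ≠ [] → u ++ w ∉ L

/-- No word of `L` is a proper suffix of a word of `L`. -/
def IsSuffixCode {A : Type} (L : Language A) : Prop :=
  ∀ u ∈ L, ∀ w : List A, w ≠ [] → w ++ u ∉ L

/-- `V` is closed under bideterministic product: over every finite alphabet, `L a K` is
`V`-recognizable whenever `a` is a letter, each of `L` and `K` is a `V`-recognizable `+`-language
or the language `1` whose only word is the empty one, `L a` is a prefix code and `a K` is a suffix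
code. -/
def Pseudovariety.ClosedUnderBideterministicProduct (V : Pseudovariety) : Prop :=
  ∀ (A : Type) [Finite A] (L K : Language A) (a : A),
    (V.Recognizable L ∨ L = 1) → (V.Recognizable K ∨ K = 1) →
    IsPrefixCode (L * ({[a]} : Language A)) → IsSuffixCode (({[a]} : Language A) * K) →
    V.Recognizable (L * ({[a]} : Language A) * K)

/-! ### Topology on a semigroup with an isolated neutral element adjoined -/

namespace WithOne

/-! The basis consists of all pseudoidentities between `W`-multiregular pseudowords that hold in
`V`. By Reiterman's theorem it is enough that every `u = v` holding in `V` follows from them.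

Since `W` is organizing, `u` and `v` are products of letters and `W`-multiregular factors. Suppose
that a letter `a` is absorbed in `V` by its left neighbour: `[x] = [x] a m`. By compactness `m` can
be chosen with `am` idempotent. The basis then identifies `x` with `x(am)`, hence `xa` with
`x(ama)`. The latter is multiregular because `ama` is regular, so a letter has disappeared; right
neighbours are treated dually. Repetition leads to factorizations in which no letter is absorbed by
a neighbour (`exists_goodFactorization`).

Such good factorizations are unique in the free pro-`V` monoid (`GoodFactorization.unique`), so the
factors of `u` and `v` agree in `V` one by one, and the basis identifies them. Uniqueness rests on
`CutProperty`: two factorizations can be compared at a good cut as if they were factorizations of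
words. Closure under bideterministic product gives this: near a good cut `x a y` there are languages
`L`, `K` for which `La` is a prefix code and `aK` a suffix code. So `LaK` is recognizable, words
close to `x a y` are cut into words close to `x` and `y`, and the comparison passes to the limit. -/

theorem mapMulHom_surjective {α β : Type*} [Mul α] [Mul β] {f : α →ₙ* β} (hf : Function.Surjective f) :
    Function.Surjective (mapMulHom f) := by
  intro y
  induction y using WithOne.recOneCoe with
  | one => exact ⟨1, map_one _⟩
  | coe b =>
    obtain ⟨a, rfl⟩ := hf b
    exact ⟨a, rfl⟩

/-- The topology on `WithOne α` in which `1` is isolated and `α` is an open subspace. -/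
instance instTopologicalSpace {α : Type*} [TopologicalSpace α] : TopologicalSpace (WithOne α) :=
  TopologicalSpace.coinduced ((↑) : α → WithOne α) ‹_›

variable {α β : Type*} [TopologicalSpace α] [TopologicalSpace β]

theorem isOpen_iff {s : Set (WithOne α)} : IsOpen s ↔ IsOpen (((↑) : α → WithOne α) ⁻¹' s) :=
  isOpen_coinduced

theorem isOpenEmbedding_coe : Topology.IsOpenEmbedding ((↑) : α → WithOne α) :=
  .of_continuous_injective_isOpenMap continuous_coinduced_rng (fun _ _ h => coe_inj.mp h)
    fun s hs => by rwa [isOpen_iff, Set.preimage_image_eq _ fun _ _ h => coe_inj.mp h]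

theorem isOpen_singleton_one : IsOpen ({1} : Set (WithOne α)) := by
  rw [isOpen_iff]
  convert isOpen_empty
  ext x
  simp

theorem nhds_one : nhds (1 : WithOne α) = pure 1 :=
  (isOpen_singleton_iff_nhds_eq_pure _).mp isOpen_singleton_one

theorem nhds_coe (a : α) : nhds (a : WithOne α) = Filter.map (↑) (nhds a) :=
  (isOpenEmbedding_coe.map_nhds_eq a).symm

instance instCompactSpace [CompactSpace α] : CompactSpace (WithOne α) := by
  constructor
  have h : (Set.univ : Set (WithOne α)) = {1} ∪ Set.range ((↑) : α → WithOne α) := by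
    ext x
    induction x using WithOne.recOneCoe <;> simp
  rw [h]
  exact isCompact_singleton.union (isCompact_range isOpenEmbedding_coe.continuous)

instance instT2Space [T2Space α] : T2Space (WithOne α) := by
  refine t2_iff_nhds.mpr fun {x y} h => ?_
  induction x using WithOne.recOneCoe with
  | one =>
    induction y using WithOne.recOneCoe with
    | one => rfl
    | coe b =>
      rw [nhds_one, nhds_coe] at h
      obtain ⟨u, rfl, v, hv⟩ := (h.nonempty_of_mem (Filter.inter_mem_inf
        (show ({1} : Set (WithOne α)) ∈ pure 1 by simp)
        (Filter.image_mem_map Filter.univ_mem)))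
      simp at hv
  | coe a =>
    induction y using WithOne.recOneCoe with
    | one =>
      rw [nhds_one, nhds_coe] at h
      obtain ⟨u, ⟨v, hv⟩, rfl⟩ := (h.nonempty_of_mem (Filter.inter_mem_inf
        (Filter.image_mem_map Filter.univ_mem)
        (show ({1} : Set (WithOne α)) ∈ pure 1 by simp)))
      simp at hv
    | coe b =>
      rw [nhds_coe, nhds_coe, ← Filter.map_inf fun _ _ h => coe_inj.mp h, Filter.map_neBot_iff] at h
      rw [t2_iff_nhds.mp ‹_› h]

instance instContinuousMul [Mul α] [ContinuousMul α] : ContinuousMul (WithOne α) := by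
  constructor
  rw [continuous_iff_continuousAt]
  rintro ⟨x, y⟩
  rw [ContinuousAt, nhds_prod_eq]
  induction x using WithOne.recOneCoe with
  | one =>
    rw [nhds_one, Filter.pure_prod, Filter.tendsto_map'_iff]
    simpa [Function.comp_def] using (continuous_id'.tendsto _)
  | coe a =>
    induction y using WithOne.recOneCoe with
    | one =>
      rw [nhds_one, Filter.prod_pure, Filter.tendsto_map'_iff]
      simpa [Function.comp_def] using (continuous_id'.tendsto _)
    | coe b =>
      rw [nhds_coe, nhds_coe, Filter.prod_map_map_eq, Filter.tendsto_map'_iff, ← nhds_prod_eq]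
      exact ((isOpenEmbedding_coe.continuous.comp continuous_mul).tendsto (a, b))

theorem continuous_mapMulHom [Mul α] [Mul β] {f : α →ₙ* β} (hf : Continuous f) :
    Continuous (mapMulHom f) :=
  continuous_coinduced_dom.mpr (isOpenEmbedding_coe.continuous.comp hf)

end WithOne

/-! ### Uniqueness of good factorizations in an abstract monoid -/

section Factorization

variable {M A : Type*} [Monoid M]

/-- The triple `(x, a, y)` is a good cut of `x * a * y`: `x` is not fixed by right multiplication
with an element of `aM`, nor `y` by left multiplication with an element of `Ma`. -/
def IsGoodCut (x a y : M) : Prop := (∀ m, x ≠ x * a * m) ∧ ∀ m, y ≠ m * a * y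

/-- Good cuts at generators behave in `M` as factorizations of words do. -/
structure CutProperty (ι : A → M) : Prop where
  split : ∀ {x y s t : M} {a : A}, IsGoodCut x (ι a) y → x * ι a * y = s * t →
    (∃ m, x = s * m ∧ t = m * ι a * y) ∨ ∃ m, s = x * ι a * m ∧ y = m * t
  split_letter : ∀ {x y s t : M} {a b : A}, IsGoodCut x (ι a) y → x * ι a * y = s * ι b * t →
    (∃ m, x = s * ι b * m ∧ t = m * ι a * y) ∨ (∃ m, s = x * ι a * m ∧ y = m * ι b * t) ∨
      (a = b ∧ x = s ∧ y = t)

/-- The submonoid of products of regular elements. -/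
def regularMonoid (M : Type*) [Monoid M] : Submonoid M :=
  Submonoid.closure {r | ∃ z, r = r * z * r}

/-- A good cut cannot lie inside a regular factor. -/
theorem CutProperty.split_regular {ι : A → M} (hι : CutProperty ι) {x y s t r : M} {a : A}
    (h : IsGoodCut x (ι a) y) (hr : ∃ z, r = r * z * r) (e : x * ι a * y = s * r * t) :
    (∃ m, x = s * r * m ∧ t = m * ι a * y) ∨ ∃ m, s = x * ι a * m ∧ y = m * r * t := by
  obtain ⟨z, hz⟩ := hr
  rcases hι.split h e with h1 | ⟨m', h1, h1'⟩
  · exact .inl h1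
  rcases hι.split h (e.trans (mul_assoc s r t)) with ⟨m, h2, h2'⟩ | ⟨m, h2, h2'⟩
  -- The cut lies inside `r`. Writing `r = r z r` offers two copies of `r`, and the cut cannot be in
  -- both: comparison with the boundary after `r z` makes `a` absorbed by `x` or by `y`.
  · exfalso
    have e3 : x * ι a * y = s * (r * z) * (r * t) := by
      rw [e]
      nth_rw 1 [hz]
      simp only [mul_assoc]
    rcases hι.split h e3 with ⟨n, h3, h3'⟩ | ⟨n, h3, h3'⟩
    · refine h.1 (m' * z * n) ?_
      calc x = s * r * z * n := by rw [h3]; simp only [mul_assoc]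
        _ = _ := by rw [h1]; simp only [mul_assoc]
    · refine h.2 (n * m) ?_
      calc y = n * (r * t) := h3'
        _ = _ := by rw [h2']; simp only [mul_assoc]
  · exact .inr ⟨m, h2, h2'.trans (mul_assoc _ _ _).symm⟩

/-- A good cut cannot lie inside a product of regular factors. -/
theorem CutProperty.split_regularMonoid {ι : A → M} (hι : CutProperty ι) {x y s t r : M} {a : A}
    (h : IsGoodCut x (ι a) y) (hr : r ∈ regularMonoid M) (e : x * ι a * y = s * r * t) :
    (∃ m, x = s * r * m ∧ t = m * ι a * y) ∨ ∃ m, s = x * ι a * m ∧ y = m * r * t := by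
  induction hr using Submonoid.closure_induction generalizing s t with
  | mem r hr => exact hι.split_regular h hr e
  | one => simpa using hι.split h (e.trans (by rw [mul_one]))
  | mul r₁ r₂ _ _ ih₁ ih₂ =>
    rcases ih₁ (s := s) (t := r₂ * t) (by rw [e]; simp only [mul_assoc]) with
      ⟨m, h1, h1'⟩ | ⟨m, h1, h1'⟩
    · rcases ih₂ (s := s * r₁) (t := t) (by rw [e]; simp only [mul_assoc]) with
        ⟨n, h2, h2'⟩ | ⟨n, h2, h2'⟩
      · exact .inl ⟨n, by rw [h2]; simp only [mul_assoc], h2'⟩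
      · refine absurd ?_ (h.1 (n * m))
        calc x = s * r₁ * m := h1
          _ = _ := by rw [h2]; simp only [mul_assoc]
    · exact .inr ⟨m, h1, by rw [h1']; simp only [mul_assoc]⟩

/-- The product `x * a₁ * x₁ * a₂ * x₂ * ⋯` for the list `(a₁, x₁), (a₂, x₂), …`. -/
def altProd (ι : A → M) : M → List (A × M) → M
  | x, [] => x
  | x, (a, y) :: l => x * ι a * altProd ι y l

/-- Goodness of an alternating factorization `x * a₁ * x₁ * a₂ * x₂ * ⋯`: no letter can be absorbed
by one of its neighbours. -/
def GoodFactorization (ι : A → M) : M → List (A × M) → Prop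
  | _, [] => True
  | x, (a, y) :: l => IsGoodCut x (ι a) y ∧ GoodFactorization ι y l

theorem altProd_mul_left (ι : A → M) (x y : M) (l : List (A × M)) :
    altProd ι (x * y) l = x * altProd ι y l := by
  cases l <;> simp [altProd, mul_assoc]

theorem map_altProd {N : Type*} [Monoid N] (f : M →* N) (ι : A → M) (x : M) (l : List (A × M)) :
    f (altProd ι x l) = altProd (f ∘ ι) (f x) (l.map (Prod.map id f)) := by
  induction l generalizing x with
  | nil => rfl
  | cons p l ih => simp [altProd, ih]

/-- Goodness constrains only adjacent factors; this extends it to the whole tail. If `xaY =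
(mbx)aY`, comparing the two cuts at `a` yields `Y = naY`, excluded by induction, or `x = mbx`. -/
theorem GoodFactorization.altProd_ne {ι : A → M} (hι : CutProperty ι) {b x : M} {l : List (A × M)}
    (hb : ∀ m, x ≠ m * b * x) (h : GoodFactorization ι x l) (m : M) :
    altProd ι x l ≠ m * b * altProd ι x l := by
  induction l generalizing b x m with
  | nil => exact hb m
  | cons p l ih =>
    obtain ⟨a, y⟩ := p
    intro e
    have hY := ih h.1.2 h.2
    have hc : IsGoodCut x (ι a) (altProd ι y l) := ⟨h.1.1, hY⟩
    have e' : x * ι a * altProd ι y l = m * b * x * ι a * altProd ι y l := by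
      simpa [altProd, mul_assoc] using e
    rcases hι.split_letter hc e' with ⟨n, -, h2⟩ | ⟨n, -, h2⟩ | ⟨-, h2, -⟩
    · exact hY n h2
    · exact hY n h2
    · exact hb m h2

theorem GoodFactorization.isGoodCut {ι : A → M} (hι : CutProperty ι) {x y : M} {a : A}
    {l : List (A × M)} (h : GoodFactorization ι x ((a, y) :: l)) :
    IsGoodCut x (ι a) (altProd ι y l) :=
  ⟨h.1.1, h.2.altProd_ne hι h.1.2⟩

/-- The cut would have to lie outside `r = 1 * r * 1`, making `may` or `xam` equal to `1`, whence `y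
= (ym)ay` or `x = xa(mx)`. -/
theorem CutProperty.ne_of_mem_regularMonoid {ι : A → M} (hι : CutProperty ι) {x y r : M} {a : A}
    (h : IsGoodCut x (ι a) y) (hr : r ∈ regularMonoid M) : r ≠ x * ι a * y := by
  intro e
  rcases hι.split_regularMonoid (s := 1) (t := 1) h hr (by simp [e]) with ⟨m, -, h2⟩ | ⟨m, h2, -⟩
  · refine h.2 (y * m) ?_
    rw [mul_assoc y, mul_assoc y, ← h2, mul_one]
  · refine h.1 (m * x) ?_
    rw [← mul_assoc, ← h2, one_mul]

/-- Good factorizations are unique. -/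
theorem GoodFactorization.unique {ι : A → M} (hι : CutProperty ι) {x y : M} {l k : List (A × M)}
    (hl : GoodFactorization ι x l) (hk : GoodFactorization ι y k)
    (hx : x ∈ regularMonoid M) (hy : y ∈ regularMonoid M)
    (hlr : ∀ p ∈ l, p.2 ∈ regularMonoid M) (hkr : ∀ p ∈ k, p.2 ∈ regularMonoid M)
    (e : altProd ι x l = altProd ι y k) : x = y ∧ l = k := by
  induction l generalizing x y k with
  | nil =>
    cases k with
    | nil => exact ⟨e, rfl⟩
    | cons q k => exact absurd e (hι.ne_of_mem_regularMonoid (hk.isGoodCut hι) hx)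
  | cons p l ih =>
    cases k with
    | nil => exact absurd e.symm (hι.ne_of_mem_regularMonoid (hl.isGoodCut hι) hy)
    | cons q k =>
      obtain ⟨a, x₁⟩ := p
      obtain ⟨b, y₁⟩ := q
      have cx := hl.isGoodCut hι
      have cy := hk.isGoodCut hι
      simp only [altProd] at e
      rcases hι.split_letter cx e with ⟨m, h1, h1'⟩ | ⟨m, h1, h1'⟩ | ⟨rfl, rfl, h1⟩
      -- Here `x = ybm`, so the first cut of the second factorization lies inside the regular
      -- product `x`, which `split_regularMonoid` forbids. The next case is symmetric.
      · exfalso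
        rcases hι.split_regularMonoid (s := 1) (t := ι a * altProd ι x₁ l) cy hx
          (by rw [← e]; simp [mul_assoc]) with ⟨n, h2, -⟩ | ⟨n, h2, -⟩
        · refine cy.1 (m * n) ?_
          rw [one_mul, h1] at h2
          rw [← mul_assoc]
          exact h2
        · refine cy.1 (n * y) ?_
          rw [← mul_assoc, ← h2, one_mul]
      · exfalso
        rcases hι.split_regularMonoid (s := 1) (t := ι b * altProd ι y₁ k) cx hy
          (by rw [e]; simp [mul_assoc]) with ⟨n, h2, -⟩ | ⟨n, h2, -⟩
        · refine cx.1 (m * n) ?_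
          rw [one_mul, h1] at h2
          rw [← mul_assoc]
          exact h2
        · refine cx.1 (n * x) ?_
          rw [← mul_assoc, ← h2, one_mul]
      · obtain ⟨rfl, rfl⟩ := ih hl.2 hk.2 (hlr (a, x₁) (by simp)) (hkr (a, y₁) (by simp))
          (fun p hp => hlr p (by simp [hp])) (fun p hp => hkr p (by simp [hp])) h1
        exact ⟨rfl, rfl⟩

end Factorization

/-! ### Neighbourhoods in the free pro-`V` monoid and recognizable languages -/

namespace Pseudovariety

variable {V : Pseudovariety} {A : Type}

theorem apply_eq_map (u : V.FreePro A) {c d : V.Cong A} (h : d.1 ≤ c.1) :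
    (u.1 c : c.1.Quotient) = Con.liftOn (c := d.1) (u.1 d : d.1.Quotient)
      (fun w => (w : c.1.Quotient)) (fun _ _ hw => (Con.eq _).mpr (h hw)) := by
  let g : V.FinQuot A d → V.FinQuot A c := fun q => Con.liftOn (c := d.1) q
      (fun w => (w : c.1.Quotient)) (fun _ _ hw => (Con.eq _).mpr (h hw))
  have hg : Continuous g := continuous_of_discreteTopology
  have he : ∀ e : V.Cong A, Continuous fun u : V.FreePro A => u.1 e := fun e =>
    (continuous_apply e).comp continuous_subtype_val
  exact congrFun ((V.denseRange_ofWord A).equalizer (he c) (hg.comp (he d)) rfl) u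

theorem apply_eq_of_le {u v : V.FreePro A} {c d : V.Cong A} (h : d.1 ≤ c.1)
    (e : u.1 d = v.1 d) : u.1 c = v.1 c :=
  (apply_eq_map u h).trans (by rw [e]; exact (apply_eq_map v h).symm)

theorem exists_le_cong (c d : V.Cong A) (hA : Nonempty (FreeSemigroup A)) :
    ∃ e : V.Cong A, e.1 ≤ c.1 ∧ e.1 ≤ d.1 := by
  let f : FreeSemigroup A →ₙ* c.1.Quotient × d.1.Quotient := ⟨fun w => (w, w), fun _ _ => rfl⟩
  refine ⟨⟨Con.ker f, V.ker_mem (V.prod_mem _ _ c.2 d.2) f hA⟩, fun _ _ h => ?_, fun _ _ h => ?_⟩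
  · exact (Con.eq _).mp (congrArg Prod.fst h)
  · exact (Con.eq _).mp (congrArg Prod.snd h)

theorem nonempty_cong (hA : Nonempty (FreeSemigroup A)) : Nonempty (V.Cong A) :=
  ⟨⟨Con.ker ⟨fun _ => (), fun _ _ => rfl⟩, V.ker_mem V.unit_mem _ hA⟩⟩

/-- Congruences with quotient in `V` are directed under refinement, so a single coordinate suffices
for a basic neighbourhood. -/
theorem exists_cong_of_mem_nhds {u : V.FreePro A} {U : Set (V.FreePro A)} (hU : U ∈ nhds u) :
    ∃ c : V.Cong A, ∀ v : V.FreePro A, v.1 c = u.1 c → v ∈ U := by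
  have hA := nonempty_of_freePro u
  have := nonempty_cong (V := V) hA
  have h : nhds u = ⨅ c : V.Cong A, Filter.principal {v | v.1 c = u.1 c} := by
    rw [nhds_subtype_eq_comap, nhds_pi, Filter.pi, Filter.comap_iInf]
    refine iInf_congr fun c => ?_
    rw [nhds_discrete, Filter.comap_pure, Filter.comap_principal]
    rfl
  rw [h, Filter.mem_iInf_of_directed] at hU
  · obtain ⟨c, hc⟩ := hU
    exact ⟨c, fun v hv => hc hv⟩
  · intro c d
    obtain ⟨e, hc, hd⟩ := exists_le_cong c d hA
    exact ⟨e, Filter.principal_mono.mpr fun v => apply_eq_of_le hc,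
      Filter.principal_mono.mpr fun v => apply_eq_of_le hd⟩

/-- The letter `a` in the free pro-`V` monoid. -/
def gen (V : Pseudovariety) {A : Type} (a : A) : WithOne (V.FreePro A) := (V.letter A a : V.FreePro A)

/-- The image of a word in the free pro-`V` semigroup with a neutral element adjoined. -/
def word (V : Pseudovariety) {A : Type} (w : List A) : WithOne (V.FreePro A) :=
  (w.map V.gen).prod

theorem word_append (w z : List A) : V.word (w ++ z) = V.word w * V.word z := by simp [word]

theorem word_cons (a : A) (w : List A) : V.word (a :: w) = V.gen a * V.word w := by simp [word]

theorem word_nil : V.word ([] : List A) = 1 := rfl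

theorem word_head_tail (w : FreeSemigroup A) :
    V.word (w.head :: w.tail) = (V.ofWord A w : V.FreePro A) := by
  obtain ⟨a, l⟩ := w
  induction l generalizing a with
  | nil => simp [word, gen]; rfl
  | cons b l ih =>
    rw [word_cons, ih, gen, ← WithOne.coe_mul, letter, ← map_mul]
    rfl

theorem word_eq_one_iff {w : List A} : V.word w = 1 ↔ w = [] := by
  refine ⟨fun h => ?_, fun h => h ▸ word_nil⟩
  cases w with
  | nil => rfl
  | cons a l => exact absurd ((word_head_tail ⟨a, l⟩).symm.trans h) WithOne.coe_ne_one

theorem denseRange_word : DenseRange (V.word (A := A)) := by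
  intro x
  induction x with
  | one => exact subset_closure ⟨[], rfl⟩
  | coe u =>
    have h := map_mem_closure WithOne.isOpenEmbedding_coe.continuous (V.denseRange_ofWord A u)
      (t := Set.range (V.word (A := A)))
    exact h (by rintro _ ⟨w, rfl⟩; exact ⟨_, word_head_tail w⟩)

theorem Recognizable.exists_isClopen {J : Language A} (hJ : V.Recognizable J) :
    ∃ C : Set (WithOne (V.FreePro A)), IsClopen C ∧ ∀ w, V.word w ∈ C ↔ w ∈ J := by
  obtain ⟨L, rfl, S, _, φ, hS, hL⟩ := hJ
  let : TopologicalSpace S := ⊥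
  have : DiscreteTopology S := ⟨rfl⟩
  have hφ : ∀ w, V.extend hS (φ ∘ FreeSemigroup.of) (V.ofWord A w) = φ w := fun w => by
    rw [extend_ofWord, FreeSemigroup.lift_comp_of']
  have hD : IsClopen (V.extend hS (φ ∘ FreeSemigroup.of) ⁻¹' (φ '' L)) :=
    (isClopen_discrete _).preimage (V.continuous_extend hS _)
  have hp : ∀ D : Set (V.FreePro A), ((↑) : V.FreePro A → WithOne (V.FreePro A)) ⁻¹'
      (((↑) : V.FreePro A → WithOne (V.FreePro A)) '' D) = D := fun D =>
    Set.preimage_image_eq _ fun _ _ h => WithOne.coe_inj.mp h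
  refine ⟨(↑) '' (V.extend hS (φ ∘ FreeSemigroup.of) ⁻¹' (φ '' L)), ⟨?_, ?_⟩, fun w => ?_⟩
  · exact isClosed_coinduced.mpr ((hp _).symm ▸ hD.1)
  · exact isOpen_coinduced.mpr ((hp _).symm ▸ hD.2)
  · cases w with
    | nil =>
      refine iff_of_false ?_ ?_
      · rintro ⟨u, -, hu⟩
        exact WithOne.coe_ne_one hu
      · rintro ⟨w, -, hw⟩
        exact List.cons_ne_nil _ _ hw
    | cons a l =>
      have : V.word (a :: l) = (V.ofWord A ⟨a, l⟩ : V.FreePro A) := word_head_tail ⟨a, l⟩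
      rw [this, ← Set.mem_preimage, hp, Set.mem_preimage, hφ, ← Set.mem_preimage, ← hL]
      constructor
      · exact fun h => ⟨⟨a, l⟩, h, rfl⟩
      · rintro ⟨⟨b, k⟩, hw, e⟩
        obtain ⟨rfl, rfl⟩ := List.cons_eq_cons.mp e
        exact hw

/-- `L` is `{1}` or one class of a congruence. Its words all lie in `U`, and it contains every word
close to `x`. -/
theorem exists_recognizable_of_mem_nhds {x : WithOne (V.FreePro A)} {U : Set (WithOne (V.FreePro A))}
    (hU : U ∈ nhds x) : ∃ L : Language A, (V.Recognizable L ∨ L = 1) ∧ (∀ w ∈ L, V.word w ∈ U) ∧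
      ∃ O ∈ nhds x, ∀ w, V.word w ∈ O → w ∈ L := by
  induction x with
  | one =>
    refine ⟨1, .inr rfl, ?_, {1}, WithOne.isOpen_singleton_one.mem_nhds rfl, fun w hw => ?_⟩
    · intro w hw
      rw [Language.mem_one] at hw
      subst hw
      exact mem_of_mem_nhds hU
    · exact (Language.mem_one w).mpr (word_eq_one_iff.mp hw)
  | coe u =>
    rw [WithOne.nhds_coe, Filter.mem_map] at hU
    obtain ⟨c, hc⟩ := exists_cong_of_mem_nhds hU
    let φ : FreeSemigroup A →ₙ* c.1.Quotient := ⟨fun w => w, fun _ _ => rfl⟩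
    refine ⟨(fun w : FreeSemigroup A => w.head :: w.tail) '' {w | φ w = u.1 c},
      .inl ⟨_, rfl, c.1.Quotient, inferInstance, φ, c.2, ?_⟩, ?_,
      (↑) '' {v : V.FreePro A | v.1 c = u.1 c}, ?_, ?_⟩
    · refine Set.Subset.antisymm (Set.subset_preimage_image _ _) ?_
      rintro w ⟨z, hz, hw⟩
      exact hw.symm.trans hz
    · rintro _ ⟨w, hw, rfl⟩
      simp only
      rw [word_head_tail]
      exact hc _ hw
    · rw [WithOne.nhds_coe]
      refine Filter.image_mem_map (IsOpen.mem_nhds ?_ rfl)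
      exact (isOpen_discrete {u.1 c}).preimage ((continuous_apply c).comp continuous_subtype_val)
    · rintro w ⟨v, hv, e⟩
      cases w with
      | nil => exact absurd e WithOne.coe_ne_one
      | cons a l =>
        have := e.trans (word_head_tail (V := V) ⟨a, l⟩)
        rw [WithOne.coe_inj] at this
        subst this
        exact ⟨⟨a, l⟩, hv, rfl⟩

/-! ### From bideterministic products to the cut property -/

section Code

variable {x : WithOne (V.FreePro A)} {a : A}

/-- The pairs `(y, yam)` form a compact, hence closed, set that misses `(x, x)`; a box around `(x,
x)` avoids it. -/
theorem exists_nhds_prefix (h : ∀ m, x ≠ x * V.gen a * m) :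
    ∃ U ∈ nhds x, ∀ l l' z : List A, V.word l ∈ U → V.word l' ∈ U → l' ≠ l ++ a :: z := by
  have hE : IsClosed (Set.range fun p : WithOne (V.FreePro A) × WithOne (V.FreePro A) =>
      (p.1, p.1 * V.gen a * p.2)) := (isCompact_range (by fun_prop)).isClosed
  have hx : (x, x) ∉ Set.range fun p : WithOne (V.FreePro A) × WithOne (V.FreePro A) =>
      (p.1, p.1 * V.gen a * p.2) := by
    rintro ⟨⟨y, m⟩, e⟩
    obtain ⟨rfl, e⟩ := Prod.mk.inj e
    exact h m e.symm
  obtain ⟨U, hU, U', hU', hs⟩ := mem_nhds_prod_iff.mp (hE.isOpen_compl.mem_nhds hx)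
  refine ⟨U ∩ U', Filter.inter_mem hU hU', ?_⟩
  rintro l _ z hl hl' rfl
  refine hs (Set.mk_mem_prod hl.1 hl'.2) ⟨(V.word l, V.word z), ?_⟩
  simp [word_append, word_cons, mul_assoc]

theorem exists_nhds_suffix (h : ∀ m, x ≠ m * V.gen a * x) :
    ∃ U ∈ nhds x, ∀ l l' z : List A, V.word l ∈ U → V.word l' ∈ U → l' ≠ z ++ a :: l := by
  have hE : IsClosed (Set.range fun p : WithOne (V.FreePro A) × WithOne (V.FreePro A) =>
      (p.1, p.2 * V.gen a * p.1)) := (isCompact_range (by fun_prop)).isClosed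
  have hx : (x, x) ∉ Set.range fun p : WithOne (V.FreePro A) × WithOne (V.FreePro A) =>
      (p.1, p.2 * V.gen a * p.1) := by
    rintro ⟨⟨y, m⟩, e⟩
    obtain ⟨rfl, e⟩ := Prod.mk.inj e
    exact h m e.symm
  obtain ⟨U, hU, U', hU', hs⟩ := mem_nhds_prod_iff.mp (hE.isOpen_compl.mem_nhds hx)
  refine ⟨U ∩ U', Filter.inter_mem hU hU', ?_⟩
  rintro l _ z hl hl' rfl
  refine hs (Set.mk_mem_prod hl.1 hl'.2) ⟨(V.word l, V.word z), ?_⟩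
  simp [word_append, word_cons, mul_assoc]

end Code

theorem _root_.isPrefixCode_mul_singleton {L : Language A} {a : A}
    (h : ∀ l ∈ L, ∀ l' ∈ L, ∀ z, l' ≠ l ++ a :: z) :
    IsPrefixCode (L * ({[a]} : Language A)) := by
  intro u hu w hw hv
  obtain ⟨l, hl, _, rfl, rfl⟩ := Language.mem_mul.mp hu
  obtain ⟨l', hl', _, rfl, e⟩ := Language.mem_mul.mp hv
  obtain rfl | ⟨z, b, rfl⟩ := w.eq_nil_or_concat
  · exact hw rfl
  · rw [List.concat_eq_append, ← List.append_assoc] at e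
    obtain ⟨e, -⟩ := List.append_inj' e rfl
    exact h l hl l' hl' z (by simpa using e)

theorem _root_.isSuffixCode_singleton_mul {K : Language A} {a : A}
    (h : ∀ k ∈ K, ∀ k' ∈ K, ∀ z, k' ≠ z ++ a :: k) :
    IsSuffixCode (({[a]} : Language A) * K) := by
  intro u hu w hw hv
  obtain ⟨_, rfl, k, hk, rfl⟩ := Language.mem_mul.mp hu
  obtain ⟨_, rfl, k', hk', e⟩ := Language.mem_mul.mp hv
  cases w with
  | nil => exact hw rfl
  | cons b z =>
    obtain ⟨-, e⟩ := List.cons_eq_cons.mp e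
    exact h k hk k' hk' z (by simpa using e)

/-- Words close to a pseudoword with a good cut can be cut accordingly. -/
theorem ClosedUnderBideterministicProduct.exists_nhds (hV : V.ClosedUnderBideterministicProduct)
    [Finite A] {x y : WithOne (V.FreePro A)} {a : A} (h : IsGoodCut x (V.gen a) y)
    {U T : Set (WithOne (V.FreePro A))} (hU : U ∈ nhds x) (hT : T ∈ nhds y) :
    ∃ C ∈ nhds (x * V.gen a * y), ∀ w, V.word w ∈ C →
      ∃ l k, V.word l ∈ U ∧ V.word k ∈ T ∧ w = l ++ a :: k := by
  obtain ⟨U', hU', hp⟩ := exists_nhds_prefix h.1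
  obtain ⟨T', hT', hs⟩ := exists_nhds_suffix h.2
  obtain ⟨L, hL, hLU, O, hO, hOL⟩ := exists_recognizable_of_mem_nhds (Filter.inter_mem hU hU')
  obtain ⟨K, hK, hKT, Q, hQ, hQK⟩ := exists_recognizable_of_mem_nhds (Filter.inter_mem hT hT')
  have hLK : V.Recognizable (L * ({[a]} : Language A) * K) := hV A L K a hL hK
    (isPrefixCode_mul_singleton fun l hl l' hl' z => hp l l' z (hLU l hl).2 (hLU l' hl').2)
    (isSuffixCode_singleton_mul fun k hk k' hk' z => hs k k' z (hKT k hk).2 (hKT k' hk').2)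
  obtain ⟨C, hC, hCw⟩ := hLK.exists_isClopen
  refine ⟨C, hC.2.mem_nhds ?_, fun w hw => ?_⟩
  -- The complement of `C` is open, so otherwise words `l`, `k` close to `x`, `y` would have `lak`
  -- outside `C` although `lak` is in `LaK`.
  · by_contra hn
    have hc : Continuous fun p : WithOne (V.FreePro A) × WithOne (V.FreePro A) =>
      p.1 * V.gen a * p.2 := by fun_prop
    have hN := (hc.tendsto (x, y)).eventually (hC.1.isOpen_compl.mem_nhds hn)
    obtain ⟨⟨l, k⟩, hlk, hl, hk⟩ := (denseRange_word.prodMap denseRange_word).exists_mem_open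
      isOpen_interior ⟨(x, y), mem_interior_iff_mem_nhds.mpr
        (Filter.inter_mem hN (prod_mem_nhds hO hQ))⟩ |>.imp fun _ h => interior_subset h
    refine hlk ?_
    have hw : V.word (l ++ [a] ++ k) ∈ C := (hCw _).mpr
      (Language.append_mem_mul (Language.append_mem_mul (hOL l hl) rfl) (hQK k hk))
    simpa [word_append, word_cons, word_nil, mul_assoc] using hw
  · obtain ⟨_, hla, k, hk, rfl⟩ := Language.mem_mul.mp ((hCw w).mp hw)
    obtain ⟨l, hl, _, rfl, rfl⟩ := Language.mem_mul.mp hla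
    exact ⟨l, k, (hLU l hl).1, (hKT k hk).1, by simp⟩

/-- A closed relation which holds for the factors of words holds for those of pseudowords. -/
theorem ClosedUnderBideterministicProduct.mem_of_isClosed
    (hV : V.ClosedUnderBideterministicProduct) [Finite A] {x y s t : WithOne (V.FreePro A)} {a : A}
    (h : IsGoodCut x (V.gen a) y) (z : List A) (e : x * V.gen a * y = s * V.word z * t)
    {E : Set (WithOne (V.FreePro A) × WithOne (V.FreePro A) × WithOne (V.FreePro A) ×
      WithOne (V.FreePro A))} (hE : IsClosed E)
    (hw : ∀ l s' t' k : List A, l ++ a :: k = s' ++ (z ++ t') →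
      (V.word l, V.word s', V.word t', V.word k) ∈ E) : (x, s, t, y) ∈ E := by
  by_contra hn
  obtain ⟨U, hU, N₁, hN₁, h₁⟩ := mem_nhds_prod_iff.mp (hE.isOpen_compl.mem_nhds hn)
  obtain ⟨S, hS, N₂, hN₂, h₂⟩ := mem_nhds_prod_iff.mp hN₁
  obtain ⟨T, hT, Y, hY, h₃⟩ := mem_nhds_prod_iff.mp hN₂
  obtain ⟨C, hC, hCw⟩ := hV.exists_nhds h hU hY
  -- The neighbourhood of `xay` is now one of `szt`: words close to `s` and `t` give a product
  -- `s'zt'` that can also be cut at `a`.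
  rw [e] at hC
  have hc : Continuous fun p : WithOne (V.FreePro A) × WithOne (V.FreePro A) =>
    p.1 * V.word z * p.2 := by fun_prop
  obtain ⟨⟨s', t'⟩, hst, hs', ht'⟩ := (denseRange_word.prodMap denseRange_word).exists_mem_open
    isOpen_interior ⟨(s, t), mem_interior_iff_mem_nhds.mpr
      (Filter.inter_mem ((hc.tendsto (s, t)).eventually hC) (prod_mem_nhds hS hT))⟩
    |>.imp fun _ h => interior_subset h
  obtain ⟨l, k, hl, hk, e'⟩ := hCw (s' ++ z ++ t') (by rw [word_append, word_append]; exact hst)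
  exact h₁ (Set.mk_mem_prod hl (h₂ (Set.mk_mem_prod hs' (h₃ (Set.mk_mem_prod ht' hk)))))
    (hw l s' t' k (by rw [← e', List.append_assoc]))

/-- Each alternative is a continuous image of a compact space, hence a closed relation on `(x, s, t,
y)`; for words it is the comparison of two cut positions. In `hE₁` the factor `z` precedes the
letter `a`, in `hE₂` it follows. The choice `z = []` gives `split`, `z = [b]` gives `split_letter`.
-/
theorem ClosedUnderBideterministicProduct.cutProperty
    (hV : V.ClosedUnderBideterministicProduct) [Finite A] : CutProperty (V.gen (A := A)) := by
  have hE₁ : ∀ (a : A) (z : List A), IsClosed (Set.range fun p : WithOne (V.FreePro A) ×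
      WithOne (V.FreePro A) × WithOne (V.FreePro A) =>
      (p.1 * V.word z * p.2.1, p.1, p.2.1 * V.gen a * p.2.2, p.2.2)) := fun a z =>
    (isCompact_range (by fun_prop)).isClosed
  have hE₂ : ∀ (a : A) (z : List A), IsClosed (Set.range fun p : WithOne (V.FreePro A) ×
      WithOne (V.FreePro A) × WithOne (V.FreePro A) =>
      (p.1, p.1 * V.gen a * p.2.1, p.2.2, p.2.1 * V.word z * p.2.2)) := fun a z =>
    (isCompact_range (by fun_prop)).isClosed
  have hE₃ : IsClosed (Set.range fun p : WithOne (V.FreePro A) × WithOne (V.FreePro A) =>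
      (p.1, p.1, p.2, p.2)) := (isCompact_range (by fun_prop)).isClosed
  constructor
  · intro x y s t a h e
    have := hV.mem_of_isClosed (s := s) (t := t) h [] (by rw [e, word_nil, mul_one])
      ((hE₁ a []).union (hE₂ a [])) fun l s' t' k e => ?_
    · rcases this with ⟨⟨p, q, r⟩, e⟩ | ⟨⟨p, q, r⟩, e⟩
      · simp only [Prod.mk.injEq, word_nil, mul_one] at e
        obtain ⟨rfl, rfl, rfl, rfl⟩ := e
        exact .inl ⟨q, rfl, rfl⟩
      · simp only [Prod.mk.injEq, word_nil, mul_one] at e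
        obtain ⟨rfl, rfl, rfl, rfl⟩ := e
        exact .inr ⟨q, rfl, rfl⟩
    · rcases List.append_eq_append_iff.mp e with ⟨m, rfl, e'⟩ | ⟨m, rfl, e'⟩
      · cases m with
        -- Here `l = s'`, so `a` is the first letter of `t'`: the first alternative holds with `m =
        -- 1`.
        | nil =>
          refine .inl ⟨(V.word l, 1, V.word k), ?_⟩
          rw [List.nil_append, List.nil_append] at e'
          simp [← e', word_nil, word_cons]
        | cons b m =>
          obtain ⟨rfl, rfl⟩ := List.cons_eq_cons.mp e'
          refine .inr ⟨(V.word l, V.word m, V.word t'), ?_⟩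
          simp [word_append, word_cons, word_nil, mul_assoc]
      · refine .inl ⟨(V.word s', V.word m, V.word k), ?_⟩
        rw [List.nil_append] at e'
        simp [e', word_append, word_cons, word_nil, mul_assoc]
  · intro x y s t a b h e
    have := hV.mem_of_isClosed (s := s) (t := t) h [b] (by rw [e, word_cons, word_nil, mul_one])
      (((hE₁ a [b]).union (hE₂ a [b])).union ((isClosed_const (p := a = b)).inter hE₃)) fun l s' t' k e => ?_
    · rcases this with (⟨⟨p, q, r⟩, e⟩ | ⟨⟨p, q, r⟩, e⟩) | ⟨hab, ⟨p, q⟩, e⟩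
      · simp only [Prod.mk.injEq, word_nil, word_cons, mul_one] at e
        obtain ⟨rfl, rfl, rfl, rfl⟩ := e
        exact .inl ⟨q, rfl, rfl⟩
      · simp only [Prod.mk.injEq, word_nil, word_cons, mul_one] at e
        obtain ⟨rfl, rfl, rfl, rfl⟩ := e
        exact .inr (.inl ⟨q, rfl, rfl⟩)
      · simp only [Prod.mk.injEq] at e
        obtain ⟨rfl, rfl, rfl, rfl⟩ := e
        exact .inr (.inr ⟨hab, rfl, rfl⟩)
    · rcases List.append_eq_append_iff.mp e with ⟨m, rfl, e'⟩ | ⟨m, rfl, e'⟩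
      · cases m with
        | nil =>
          obtain ⟨rfl, rfl⟩ := List.cons_eq_cons.mp e'
          exact .inr ⟨rfl, (V.word l, V.word k), by simp⟩
        | cons b m =>
          obtain ⟨rfl, rfl⟩ := List.cons_eq_cons.mp e'
          refine .inl (.inr ⟨(V.word l, V.word m, V.word t'), ?_⟩)
          simp [word_append, word_cons, word_nil, mul_assoc]
      · cases m with
        | nil =>
          obtain ⟨rfl, rfl⟩ := List.cons_eq_cons.mp e'
          exact .inr ⟨rfl, (V.word s', V.word t'), by simp⟩
        | cons c m =>
          obtain ⟨rfl, rfl⟩ := List.cons_eq_cons.mp e'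
          refine .inl (.inl ⟨(V.word s', V.word m, V.word k), ?_⟩)
          simp [word_append, word_cons, word_nil, mul_assoc]

end Pseudovariety

/-! ### Idempotents in ideals and products of regular elements -/

/-- The multiples `am` satisfying `q` form a nonempty compact semigroup, which contains an
idempotent. -/
theorem exists_idempotent_mul_left {P : Type*} [Monoid P] [TopologicalSpace P] [CompactSpace P]
    [T2Space P] [ContinuousMul P] {a : P} {q : P → Prop} (hq : IsClosed {f | q f})
    (hm : ∀ f g, q f → q g → q (f * g)) (ha : ∃ m, q (a * m)) :
    ∃ m, q (a * m) ∧ a * m * (a * m) = a * m := by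
  obtain ⟨_, ⟨⟨m, rfl⟩, hf⟩, hi⟩ := exists_idempotent_in_compact_subsemigroup
    (fun r : P => continuous_mul_const r) (Set.range (fun m => a * m) ∩ {f | q f})
    (by obtain ⟨m, hm⟩ := ha; exact ⟨_, ⟨m, rfl⟩, hm⟩)
    ((isCompact_range (by fun_prop)).inter_right hq)
    (by
      rintro _ ⟨⟨m, rfl⟩, h⟩ _ ⟨⟨n, rfl⟩, h'⟩
      exact ⟨⟨m * (a * n), by simp only [mul_assoc]⟩, hm _ _ h h'⟩)
  exact ⟨m, hf, hi⟩

theorem exists_idempotent_mul_right {P : Type*} [Monoid P] [TopologicalSpace P] [CompactSpace P]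
    [T2Space P] [ContinuousMul P] {a : P} {q : P → Prop} (hq : IsClosed {f | q f})
    (hm : ∀ f g, q f → q g → q (f * g)) (ha : ∃ m, q (m * a)) :
    ∃ m, q (m * a) ∧ m * a * (m * a) = m * a := by
  obtain ⟨_, ⟨⟨m, rfl⟩, hf⟩, hi⟩ := exists_idempotent_in_compact_subsemigroup
    (fun r : P => continuous_mul_const r) (Set.range (fun m => m * a) ∩ {f | q f})
    (by obtain ⟨m, hm⟩ := ha; exact ⟨_, ⟨m, rfl⟩, hm⟩)
    ((isCompact_range (by fun_prop)).inter_right hq)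
    (by
      rintro _ ⟨⟨m, rfl⟩, h⟩ _ ⟨⟨n, rfl⟩, h'⟩
      exact ⟨⟨m * a * n, by simp only [mul_assoc]⟩, hm _ _ h h'⟩)
  exact ⟨m, hf, hi⟩

theorem mem_regularMonoid {M : Type*} [Monoid M] {r : M} (z : M) (h : r = r * z * r) :
    r ∈ regularMonoid M :=
  Submonoid.subset_closure ⟨z, h⟩

theorem map_mem_regularMonoid {M N : Type*} [Monoid M] [Monoid N] (f : M →* N) {x : M}
    (hx : x ∈ regularMonoid M) : f x ∈ regularMonoid N := by
  have : regularMonoid M ≤ (regularMonoid N).comap f := by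
    refine Submonoid.closure_le.mpr ?_
    rintro r ⟨z, hz⟩
    refine mem_regularMonoid (f z) ?_
    rw [← map_mul, ← map_mul, ← hz]
  exact this hx

theorem coe_mem_regularMonoid_iff {S : Type} [Semigroup S] {u : S} :
    (u : WithOne S) ∈ regularMonoid (WithOne S) ↔
      u ∈ Subsemigroup.closure (Pseudovariety.regularElements S) := by
  constructor
  · suffices ∀ x ∈ regularMonoid (WithOne S), ∀ u : S, x = u →
        u ∈ Subsemigroup.closure (Pseudovariety.regularElements S) from fun h => this _ h u rfl
    intro x hx
    induction hx using Submonoid.closure_induction with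
    | mem r hr =>
      rintro u rfl
      obtain ⟨z, hz⟩ := hr
      refine Subsemigroup.subset_closure ?_
      induction z with
      | one =>
        rw [mul_one, ← WithOne.coe_mul, WithOne.coe_inj] at hz
        -- A witness `1` means `u = uu`, so `u` itself serves as a witness in `S`.
        exact ⟨u, by rw [← hz]; exact hz⟩
      | coe z => exact ⟨z, WithOne.coe_inj.mp hz⟩
    | one => exact fun u h => absurd h WithOne.one_ne_coe
    | mul x y _ _ hx hy =>
      intro u h
      induction x with
      | one => exact hy u (by rw [← h, one_mul])
      | coe x =>
        induction y with
        | one => exact hx u (by rw [← h, mul_one])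
        | coe y =>
          rw [← WithOne.coe_mul, WithOne.coe_inj] at h
          exact h ▸ mul_mem (hx x rfl) (hy y rfl)
  · intro h
    induction h using Subsemigroup.closure_induction with
    | mem x hx =>
      obtain ⟨t, ht⟩ := hx
      exact mem_regularMonoid (t : WithOne S) (congrArg ((↑) : S → WithOne S) ht)
    | mul x y _ _ hx hy =>
      rw [WithOne.coe_mul]
      exact mul_mem hx hy

/-! ### Projections and factorizations into letters and multiregular pseudowords -/

namespace Pseudovariety

variable {V W : Pseudovariety} {A : Type}

theorem proj_ofWord (V : Pseudovariety) (w : FreeSemigroup A) :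
    V.proj A (all.ofWord A w) = V.ofWord A w := rfl

theorem proj_surjective (V : Pseudovariety) (A : Type) : Function.Surjective (V.proj A) := by
  rw [← Set.range_eq_univ]
  refine (isCompact_range (V.continuous_proj A)).isClosed.closure_eq.symm.trans
    (Set.eq_univ_of_univ_subset fun u _ => ?_)
  have h : Set.range (V.ofWord A) ⊆ Set.range (V.proj A) :=
    Set.range_subset_iff.mpr fun w => ⟨all.ofWord A w, proj_ofWord V w⟩
  exact closure_mono h (V.denseRange_ofWord A u)

/-- A congruence with quotient in `V`, viewed as a congruence with quotient in `W`, for `V ≤ W`. -/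
def Cong.ofLE (h : V ≤ W) (c : V.Cong A) : W.Cong A := ⟨c.1, h _ c.2⟩

/-- The restriction of a family indexed by the congruences with quotient in `W` to the congruences
with quotient in `V`, for `V ≤ W`. -/
def restrictLE (h : V ≤ W) (A : Type) (f : (c : W.Cong A) → W.FinQuot A c) :
    (c : V.Cong A) → V.FinQuot A c :=
  fun c => f (c.ofLE h)

theorem continuous_restrictLE (h : V ≤ W) (A : Type) : Continuous (restrictLE h A) := by
  refine continuous_pi fun c => ?_
  let g : W.FinQuot A (c.ofLE h) → V.FinQuot A c := fun x => x
  have hg : Continuous g := continuous_of_discreteTopology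
  exact hg.comp (continuous_apply (c.ofLE h))

/-- The natural projection from the free pro-`W` semigroup to the free pro-`V` semigroup, for
`V ≤ W`. -/
def projLE (h : V ≤ W) (A : Type) : W.FreePro A →ₙ* V.FreePro A where
  toFun u := ⟨restrictLE h A u.1, map_mem_closure (continuous_restrictLE h A) u.2 (by
    rintro _ ⟨w, rfl⟩
    exact ⟨w, rfl⟩)⟩
  map_mul' _ _ := rfl

/-- The natural projection `[·]_V` on pseudowords with a neutral element adjoined. -/
def projOne (V : Pseudovariety) (A : Type) : WithOne (Pseudoword A) →* WithOne (V.FreePro A) :=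
  WithOne.mapMulHom (V.proj A)

theorem continuous_projOne (V : Pseudovariety) (A : Type) : Continuous (V.projOne A) :=
  WithOne.continuous_mapMulHom (V.continuous_proj A)

theorem projOne_surjective (V : Pseudovariety) (A : Type) : Function.Surjective (V.projOne A) :=
  WithOne.mapMulHom_surjective (V.proj_surjective A)

theorem projOne_eq_one_iff {x : WithOne (Pseudoword A)} : V.projOne A x = 1 ↔ x = 1 := by
  refine ⟨fun h => ?_, fun h => h ▸ map_one _⟩
  induction x with
  | one => rfl
  | coe u => exact absurd h WithOne.coe_ne_one

/-- The `W`-multiregular pseudowords together with the neutral element. -/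
def multiregularMonoid (W : Pseudovariety) (A : Type) : Submonoid (WithOne (Pseudoword A)) :=
  (regularMonoid (WithOne (W.FreePro A))).comap (W.projOne A)

theorem coe_mem_multiregularMonoid {u : Pseudoword A} :
    (u : WithOne (Pseudoword A)) ∈ W.multiregularMonoid A ↔ W.IsMultiregular u :=
  coe_mem_regularMonoid_iff

theorem regularMonoid_le_multiregularMonoid :
    regularMonoid (WithOne (Pseudoword A)) ≤ W.multiregularMonoid A :=
  fun _ => map_mem_regularMonoid (W.projOne A)

/-- The projection to `V` factors through the one to `W`, and homomorphisms preserve regularity. -/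
theorem projOne_mem_regularMonoid (h : V ≤ W) {x : WithOne (Pseudoword A)}
    (hx : x ∈ W.multiregularMonoid A) : V.projOne A x ∈ regularMonoid (WithOne (V.FreePro A)) := by
  have := map_mem_regularMonoid (WithOne.mapMulHom (projLE h A)) hx
  rwa [projOne, WithOne.mapMulHom_mapMulHom] at this

/-- The pseudowords which are products of letters and `W`-multiregular pseudowords. -/
def IsFactorizable (W : Pseudovariety) (x : WithOne (Pseudoword A)) : Prop :=
  ∃ y ∈ W.multiregularMonoid A, ∃ l : List (A × WithOne (Pseudoword A)),
    (∀ p ∈ l, p.2 ∈ W.multiregularMonoid A) ∧ x = altProd all.gen y l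

theorem isFactorizable_of_mem {x : WithOne (Pseudoword A)} (hx : x ∈ W.multiregularMonoid A) :
    W.IsFactorizable x :=
  ⟨x, hx, [], by simp, rfl⟩

/-- The neutral element counts as multiregular, so it can fill the place between consecutive
letters. -/
theorem IsFactorizable.gen_mul {x : WithOne (Pseudoword A)} (hx : W.IsFactorizable x) (a : A) :
    W.IsFactorizable (all.gen a * x) := by
  obtain ⟨y, hy, l, hl, rfl⟩ := hx
  refine ⟨1, one_mem _, (a, y) :: l, ?_, by simp [altProd]⟩
  rintro p (_ | ⟨_, hp⟩)
  exacts [hy, hl p hp]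

theorem IsFactorizable.mul_of_mem {x z : WithOne (Pseudoword A)} (hx : W.IsFactorizable x)
    (hz : z ∈ W.multiregularMonoid A) : W.IsFactorizable (z * x) := by
  obtain ⟨y, hy, l, hl, rfl⟩ := hx
  exact ⟨z * y, mul_mem hz hy, l, hl, (altProd_mul_left _ _ _ _).symm⟩

theorem IsFactorizable.word_mul {x : WithOne (Pseudoword A)} (hx : W.IsFactorizable x)
    (w : List A) : W.IsFactorizable (all.word w * x) := by
  induction w with
  | nil => simpa [word_nil] using hx
  | cons a w ih => simpa [word_cons, mul_assoc] using ih.gen_mul a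

theorem Organizing.isFactorizable [Finite A] (hW : W.Organizing) (x : WithOne (Pseudoword A)) :
    W.IsFactorizable x := by
  induction x with
  | one => exact isFactorizable_of_mem (one_mem _)
  | coe q =>
    obtain ⟨n, u, p, -, -, hp, e⟩ := hW A q
    rw [e]
    refine IsFactorizable.word_mul ?_ (u 0)
    have : ∀ l : List (WithOne (Pseudoword A)), (∀ x ∈ l, ∃ y ∈ W.multiregularMonoid A,
        ∃ w, x = y * all.word w) → W.IsFactorizable l.prod := by
      intro l hl
      induction l with
      | nil => exact isFactorizable_of_mem (one_mem _)
      | cons x l ih =>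
        obtain ⟨y, hy, w, rfl⟩ := hl x (by simp)
        rw [List.prod_cons, mul_assoc]
        exact ((ih fun x hx => hl x (by simp [hx])).word_mul w).mul_of_mem hy
    refine this _ fun x hx => ?_
    obtain ⟨i, rfl⟩ := (List.mem_ofFn' _ _).mp hx
    exact ⟨p i, coe_mem_multiregularMonoid.mpr (hp i), u i.succ, rfl⟩

/-! ### Reduction to good factorizations modulo the multiregular pseudoidentities -/

section Transfer

variable {N : Type*} [Monoid N] {Ψ : WithOne (Pseudoword A) →* N}

/-- A letter which is absorbed in `V` by the factor to its left is, modulo pseudoidentities between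
multiregular pseudowords, contained in a multiregular factor. -/
theorem exists_absorb_left (hΨ : ∀ x ∈ W.multiregularMonoid A, ∀ y ∈ W.multiregularMonoid A,
    V.projOne A x = V.projOne A y → Ψ x = Ψ y) {x : WithOne (Pseudoword A)}
    (hx : x ∈ W.multiregularMonoid A) {a : A} {m : WithOne (V.FreePro A)}
    (h : V.projOne A x = V.projOne A x * V.gen a * m) :
    ∃ y ∈ W.multiregularMonoid A, Ψ (x * all.gen a) = Ψ y := by
  obtain ⟨m, rfl⟩ := V.projOne_surjective A m
  -- The right stabilizer of `[x]` is a closed subsemigroup that meets the multiples of `a`, so `am`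
  -- can be made idempotent.
  obtain ⟨m, h₁, h₂⟩ := exists_idempotent_mul_left (a := all.gen a)
    (q := fun f => V.projOne A (x * f) = V.projOne A x)
    (isClosed_eq ((V.continuous_projOne A).comp (continuous_const_mul x)) continuous_const)
    (fun f g hf hg => by
      simp only [map_mul] at hf hg ⊢
      rw [← mul_assoc, hf, hg]) ⟨m, by
        rw [map_mul, map_mul, ← mul_assoc]
        exact h.symm⟩
  have hi := mul_mem hx (regularMonoid_le_multiregularMonoid (mem_regularMonoid 1
    (by rw [mul_one, h₂]) : all.gen a * m ∈ regularMonoid _))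
  have hg : all.gen a * m * all.gen a ∈ regularMonoid (WithOne (Pseudoword A)) :=
    mem_regularMonoid m <| by
      calc all.gen a * m * all.gen a = (all.gen a * m) * (all.gen a * m) * all.gen a := by rw [h₂]
        _ = (all.gen a * m) * (all.gen a * m) * (all.gen a * m) * all.gen a := by rw [h₂, h₂]
        _ = _ := by simp only [mul_assoc]
  refine ⟨x * (all.gen a * m * all.gen a),
    mul_mem hx (regularMonoid_le_multiregularMonoid hg), ?_⟩
  rw [map_mul, hΨ x hx _ hi h₁.symm]
  simp only [map_mul, mul_assoc]

/-- A letter which is absorbed in `V` by the factor to its right is, modulo pseudoidentities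
between multiregular pseudowords, contained in a multiregular factor. -/
theorem exists_absorb_right (hΨ : ∀ x ∈ W.multiregularMonoid A, ∀ y ∈ W.multiregularMonoid A,
    V.projOne A x = V.projOne A y → Ψ x = Ψ y) {x : WithOne (Pseudoword A)}
    (hx : x ∈ W.multiregularMonoid A) {a : A} {m : WithOne (V.FreePro A)}
    (h : V.projOne A x = m * V.gen a * V.projOne A x) :
    ∃ y ∈ W.multiregularMonoid A, Ψ (all.gen a * x) = Ψ y := by
  obtain ⟨m, rfl⟩ := V.projOne_surjective A m
  obtain ⟨m, h₁, h₂⟩ := exists_idempotent_mul_right (a := all.gen a)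
    (q := fun f => V.projOne A (f * x) = V.projOne A x)
    (isClosed_eq ((V.continuous_projOne A).comp (continuous_mul_const x)) continuous_const)
    (fun f g hf hg => by
      simp only [map_mul] at hf hg ⊢
      rw [mul_assoc, hg, hf]) ⟨m, by
        rw [map_mul, map_mul]
        exact h.symm⟩
  have hi := mul_mem (regularMonoid_le_multiregularMonoid (mem_regularMonoid 1
    (by rw [mul_one, h₂]) : m * all.gen a ∈ regularMonoid _)) hx
  have hg : all.gen a * (m * all.gen a) ∈ regularMonoid (WithOne (Pseudoword A)) :=
    mem_regularMonoid m <| by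
      calc all.gen a * (m * all.gen a)
          = all.gen a * ((m * all.gen a) * (m * all.gen a)) := by rw [h₂]
        _ = all.gen a * ((m * all.gen a) * (m * all.gen a) * (m * all.gen a)) := by rw [h₂, h₂]
        _ = _ := by simp only [mul_assoc]
  refine ⟨all.gen a * (m * all.gen a) * x,
    mul_mem (regularMonoid_le_multiregularMonoid hg) hx, ?_⟩
  rw [map_mul, hΨ x hx _ hi h₁.symm]
  simp only [map_mul, mul_assoc]

/-- At a cut that is not good, the letter and its two neighbours merge into one multiregular factor.
-/
theorem exists_shorter (hΨ : ∀ x ∈ W.multiregularMonoid A, ∀ y ∈ W.multiregularMonoid A,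
    V.projOne A x = V.projOne A y → Ψ x = Ψ y) {x : WithOne (Pseudoword A)}
    {l : List (A × WithOne (Pseudoword A))} (hx : x ∈ W.multiregularMonoid A)
    (hl : ∀ p ∈ l, p.2 ∈ W.multiregularMonoid A)
    (h : ¬ GoodFactorization V.gen (V.projOne A x) (l.map (Prod.map id (V.projOne A)))) :
    ∃ y ∈ W.multiregularMonoid A, ∃ k : List (A × WithOne (Pseudoword A)),
      (∀ p ∈ k, p.2 ∈ W.multiregularMonoid A) ∧ k.length < l.length ∧
      Ψ (altProd all.gen x l) = Ψ (altProd all.gen y k) := by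
  induction l generalizing x with
  | nil => exact absurd trivial h
  | cons p l ih =>
    obtain ⟨a, x₁⟩ := p
    have hx₁ : x₁ ∈ W.multiregularMonoid A := hl (a, x₁) (by simp)
    have hl' : ∀ p ∈ l, p.2 ∈ W.multiregularMonoid A := fun p hp => hl p (by simp [hp])
    by_cases h₁ : ∀ m, V.projOne A x ≠ V.projOne A x * V.gen a * m
    · by_cases h₂ : ∀ m, V.projOne A x₁ ≠ m * V.gen a * V.projOne A x₁
      · obtain ⟨y, hy, k, hk, hkl, e⟩ := ih hx₁ hl' fun hg => h ⟨⟨h₁, h₂⟩, hg⟩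
        refine ⟨x, hx, (a, y) :: k, ?_, by simpa using hkl, ?_⟩
        · rintro p (_ | ⟨_, hp⟩)
          exacts [hy, hk p hp]
        · simp only [altProd, map_mul, e]
      · push Not at h₂
        obtain ⟨m, hm⟩ := h₂
        obtain ⟨y, hy, e⟩ := exists_absorb_right hΨ hx₁ hm
        refine ⟨x * y, mul_mem hx hy, l, hl', by simp, ?_⟩
        have : altProd all.gen x ((a, x₁) :: l) = x * (altProd all.gen (all.gen a * x₁) l) := by
          rw [altProd_mul_left, altProd, mul_assoc]
        have h1 := altProd_mul_left all.gen (all.gen a * x₁) 1 l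
        have h2 := altProd_mul_left all.gen y 1 l
        rw [mul_one] at h1 h2
        rw [this, altProd_mul_left all.gen x y, h1, h2, map_mul Ψ x, map_mul Ψ x,
          map_mul Ψ (all.gen a * x₁), map_mul Ψ y, e]
    · push Not at h₁
      obtain ⟨m, hm⟩ := h₁
      obtain ⟨y, hy, e⟩ := exists_absorb_left hΨ hx hm
      refine ⟨y * x₁, mul_mem hy hx₁, l, hl', by simp, ?_⟩
      rw [altProd_mul_left, altProd, map_mul, e, map_mul]

theorem exists_goodFactorization [Finite A] (hW : W.Organizing)
    (hΨ : ∀ x ∈ W.multiregularMonoid A, ∀ y ∈ W.multiregularMonoid A,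
      V.projOne A x = V.projOne A y → Ψ x = Ψ y) (z : WithOne (Pseudoword A)) :
    ∃ x ∈ W.multiregularMonoid A, ∃ l : List (A × WithOne (Pseudoword A)),
      (∀ p ∈ l, p.2 ∈ W.multiregularMonoid A) ∧
      GoodFactorization V.gen (V.projOne A x) (l.map (Prod.map id (V.projOne A))) ∧
      Ψ z = Ψ (altProd all.gen x l) := by
  obtain ⟨x, hx, l, hl, rfl⟩ := hW.isFactorizable z
  induction hn : l.length using Nat.strong_induction_on generalizing x l with
  | _ n ih =>
    by_cases h : GoodFactorization V.gen (V.projOne A x) (l.map (Prod.map id (V.projOne A)))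
    · exact ⟨x, hx, l, hl, h, rfl⟩
    · obtain ⟨y, hy, k, hk, hkl, e⟩ := exists_shorter hΨ hx hl h
      obtain ⟨x', hx', l', hl', hg, e'⟩ := ih k.length (hn ▸ hkl) y hy k hk rfl
      exact ⟨x', hx', l', hl', hg, e.trans e'⟩

theorem map_altProd_eq (hΨ : ∀ x ∈ W.multiregularMonoid A, ∀ y ∈ W.multiregularMonoid A,
    V.projOne A x = V.projOne A y → Ψ x = Ψ y) {x y : WithOne (Pseudoword A)}
    {l k : List (A × WithOne (Pseudoword A))} (hx : x ∈ W.multiregularMonoid A)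
    (hy : y ∈ W.multiregularMonoid A) (hl : ∀ p ∈ l, p.2 ∈ W.multiregularMonoid A)
    (hk : ∀ p ∈ k, p.2 ∈ W.multiregularMonoid A) (e : V.projOne A x = V.projOne A y)
    (h : l.map (Prod.map id (V.projOne A)) = k.map (Prod.map id (V.projOne A))) :
    Ψ (altProd all.gen x l) = Ψ (altProd all.gen y k) := by
  induction l generalizing x y k with
  | nil =>
    obtain rfl : k = [] := by simpa using h.symm
    exact hΨ x hx y hy e
  | cons p l ih =>
    cases k with
    | nil => simp at h
    | cons q k =>
      obtain ⟨a, x₁⟩ := p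
      obtain ⟨b, y₁⟩ := q
      simp only [List.map_cons, List.cons.injEq, Prod.map_apply, id_eq, Prod.mk.injEq] at h
      obtain ⟨⟨rfl, h₁⟩, h₂⟩ := h
      simp only [altProd, map_mul]
      rw [hΨ x hx y hy e, ih (hl (a, x₁) (by simp)) (hk (a, y₁) (by simp))
        (fun p hp => hl p (by simp [hp])) (fun p hp => hk p (by simp [hp])) h₁ h₂]

/-- The equalities between pseudowords which hold in `V` follow from those between multiregular
pseudowords. -/
theorem map_eq_of_projOne_eq [Finite A] (hV : V.ClosedUnderBideterministicProduct)
    (hW : W.Organizing) (hVW : V ≤ W)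
    (hΨ : ∀ x ∈ W.multiregularMonoid A, ∀ y ∈ W.multiregularMonoid A,
      V.projOne A x = V.projOne A y → Ψ x = Ψ y)
    (hp : ∀ x y, Ψ x = Ψ y → V.projOne A x = V.projOne A y) {z w : WithOne (Pseudoword A)}
    (h : V.projOne A z = V.projOne A w) : Ψ z = Ψ w := by
  obtain ⟨x, hx, l, hl, hg, e⟩ := exists_goodFactorization hW hΨ z
  obtain ⟨y, hy, k, hk, hg', e'⟩ := exists_goodFactorization hW hΨ w
  have hgen : V.projOne A ∘ all.gen = V.gen := rfl
  have hE : altProd V.gen (V.projOne A x) (l.map (Prod.map id (V.projOne A))) =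
      altProd V.gen (V.projOne A y) (k.map (Prod.map id (V.projOne A))) := by
    -- By `hp`, the reductions made modulo `Ψ` have not changed the values in `V`.
    rw [← hgen, ← map_altProd, ← map_altProd, ← hp _ _ e, ← hp _ _ e', h]
  have hm : ∀ l : List (A × WithOne (Pseudoword A)), (∀ p ∈ l, p.2 ∈ W.multiregularMonoid A) →
      ∀ p ∈ l.map (Prod.map id (V.projOne A)), p.2 ∈ regularMonoid (WithOne (V.FreePro A)) := by
    intro l hl p hp
    obtain ⟨q, hq, rfl⟩ := List.mem_map.mp hp
    exact projOne_mem_regularMonoid hVW (hl q hq)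
  obtain ⟨h₁, h₂⟩ := hg.unique hV.cutProperty hg' (projOne_mem_regularMonoid hVW hx)
    (projOne_mem_regularMonoid hVW hy) (hm l hl) (hm k hk) hE
  rw [e, e', map_altProd_eq hΨ hx hy hl hk h₁ h₂]

end Transfer

/-! ### Reiterman's theorem and conclusion -/

theorem extend_eq_extend_proj {T : Type} [Semigroup T] (hT : V.Mem T) (φ : A → T)
    (u : Pseudoword A) :
    all.extend (V.le_all T hT) φ u = V.extend hT φ (V.proj A u) := rfl

/-- Reiterman's theorem: a finite semigroup which satisfies all pseudoidentities of `V` in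
finitely many variables belongs to `V`. -/
theorem mem_of_extend_eq {S : Type} [Semigroup S] (hS : all.Mem S)
    (h : ∀ u v : Pseudoword S, V.proj S u = V.proj S v → all.extend hS id u = all.extend hS id v) :
    V.Mem S := by
  let τ : TopologicalSpace S := ⊥
  have : DiscreteTopology S := ⟨rfl⟩
  have hA : Nonempty (FreeSemigroup S) := hS.2.map FreeSemigroup.of
  have := nonempty_cong (V := V) hA
  have hc := all.continuous_extend hS (id : S → S)
  let D : Set (Pseudoword S × Pseudoword S) :=
    {p | all.extend hS id p.1 ≠ all.extend hS id p.2}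
  have hD : IsCompact D := IsClosed.isCompact <|
    (isClosed_discrete {q : S × S | q.1 ≠ q.2}).preimage
      ((hc.comp continuous_fst).prodMk (hc.comp continuous_snd))
  have hpc : ∀ c : V.Cong S, Continuous fun u : Pseudoword S => (V.proj S u).1 c := fun c =>
    (continuous_apply c).comp (continuous_subtype_val.comp (V.continuous_proj S))
  -- Pairs separated in `S` are separated in `V`, by `h`; compactness and directedness give one
  -- congruence `c` that separates all of them. Applied to words, this makes `S` a quotient of `A⁺ /
  -- c`, with `A = S`.
  obtain ⟨c, hDc⟩ := hD.elim_directed_cover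
    (fun c : V.Cong S => {p | (V.proj S p.1).1 c ≠ (V.proj S p.2).1 c})
    (fun c => (isOpen_discrete {q : V.FinQuot S c × V.FinQuot S c | q.1 ≠ q.2}).preimage
      (((hpc c).comp continuous_fst).prodMk ((hpc c).comp continuous_snd)))
    (fun p hp => by
      by_contra hn
      simp only [Set.mem_iUnion, Set.mem_ofPred_eq, not_exists, not_not] at hn
      exact hp (h _ _ (Subtype.ext (funext hn))))
    (fun c d => by
      obtain ⟨e, hec, hed⟩ := exists_le_cong c d hA
      exact ⟨e, fun p hp he => hp (apply_eq_of_le hec he),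
        fun p hp he => hp (apply_eq_of_le hed he)⟩)
  have hk : ∀ w z, c.1 w z → FreeSemigroup.lift (id : S → S) w = FreeSemigroup.lift id z := by
    intro w z hwz
    by_contra hn
    exact hDc (show (all.ofWord S w, all.ofWord S z) ∈ D from hn) ((Con.eq _).mpr hwz)
  refine V.image_mem c.1.Quotient S ⟨fun q => Con.liftOn q (FreeSemigroup.lift id) hk, ?_⟩ ?_ c.2
  · intro x y
    induction x, y using Con.induction_on₂ with
    | _ x y => exact map_mul (FreeSemigroup.lift id) x y
  · exact fun s => ⟨(FreeSemigroup.of s : c.1.Quotient), rfl⟩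

end Pseudovariety

theorem corollary6p3 (V W : Pseudovariety) (hV : V.ClosedUnderBideterministicProduct)
    (hW : W.Organizing) (hVW : V ≤ W) : V.MultiregularlyBasedIn W := by
  refine ⟨{e | (W.IsMultiregular e.lhs ∧ W.IsMultiregular e.rhs) ∧
    V.proj _ e.lhs = V.proj _ e.rhs}, fun S _ hS => ⟨fun hVS e he φ => ?_, fun h => ?_⟩,
    fun e he => he.1⟩
  · rw [Pseudovariety.extend_eq_extend_proj hVS, he.2, Pseudovariety.extend_eq_extend_proj hVS]
  · have : Finite S := hS.1
    refine Pseudovariety.mem_of_extend_eq hS fun u v huv => ?_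
    -- The first component makes `Ψ` determine values in `V`; the second carries the desired
    -- equality in `S`.
    let Ψ := (V.projOne S).prod (WithOne.mapMulHom (Pseudovariety.all.extend hS (id : S → S)))
    have hΨ : ∀ x ∈ W.multiregularMonoid S, ∀ y ∈ W.multiregularMonoid S,
        V.projOne S x = V.projOne S y → Ψ x = Ψ y := by
      intro x hx y hy e
      refine Prod.ext e ?_
      induction x with
      | one => rw [Pseudovariety.projOne_eq_one_iff.mp (e.symm.trans (map_one _))]
      | coe x =>
        induction y with
        | one => exact absurd (e.trans (map_one _)) WithOne.coe_ne_one
        | coe y =>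
          exact congrArg ((↑) : S → WithOne S) (h ⟨S, this, x, y⟩
            ⟨⟨Pseudovariety.coe_mem_multiregularMonoid.mp hx,
              Pseudovariety.coe_mem_multiregularMonoid.mp hy⟩, WithOne.coe_inj.mp e⟩ id)
    have key := Pseudovariety.map_eq_of_projOne_eq hV hW hVW hΨ
      (fun x y e => congrArg Prod.fst e) (z := u) (w := v)
      (congrArg ((↑) : V.FreePro S → WithOne (V.FreePro S)) huv)
    exact WithOne.coe_inj.mp (congrArg Prod.snd key)
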